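/- For positive integers $s_1,\ldots,s_k$, let the generalized theta graph $\Theta_{s_1,\ldots,s_k}$ consist of two endvertices joined by $k$ internally disjoint paths of lengths $s_1,\ldots,s_k$, and write $\Theta^{(2,k)}$ for the case in which all $k$ path lengths equal $2$. The chromatic polynomial $\pi(G,\cdot)$ of a finite graph $G$ is the polynomial whose value at each $n\in\mathbb N$ is the number of proper colourings of $G$ with $n$ colours; its complex roots are the chromatic roots of $G$. Put $\rho(G)=\max\{|z-1| : z\in\mathbb C,\ \pi(G,z)=0\}$. For every $k$ the graph $\Theta^{(2,k)}$ is isomorphic to the complete bipartite graph $K_{2,k}$. For all sufficiently large $k$ it has a pair of distinct chromatic roots $z_k^+$ and $z_k^-$ with $$ z_k^{\pm} \;=\; \frac{k}{\log k-\log\log k}\left[\,1 \pm \frac{\pi i}{\log k} + O\!\left(\frac{\log\log k}{\log^2 k}\right)\right] \qquad (k\to\infty). $$ In particular $|z_k^{\pm}-1| = [1+o(1)]\,k/\log k$; and moreover $\rho(\Theta^{(2,k)}) = [1+o(1)]\,k/\log k$ as $k\to\infty$. That is, for the chromatic roots of $\Theta^{(2,k)}$ the bound $|z-1|\le[1+o(1)]\,k/\log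 k$ holds and is asymptotically attained. -/

import Mathlib

open Filter Topology Asymptotics Polynomial

section ChromaticPolynomial

variable {V : Type*}

/-- The functions `V → Fin n` that are constant along every edge in `A` correspond to the functions
on the connected components of the graph with edge set `A`. -/
theorem card_monochromatic [Finite V] (A : Set (Sym2 V)) (n : ℕ) :
    Nat.card {f : V → Fin n // ∀ e ∈ A, (e.map f).IsDiag} =
      n ^ Nat.card (SimpleGraph.fromEdgeSet A).ConnectedComponent := by
  have e : {f : V → Fin n // ∀ e ∈ A, (e.map f).IsDiag} ≃
      ((SimpleGraph.fromEdgeSet A).ConnectedComponent → Fin n) :=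
    { toFun := fun f => SimpleGraph.ConnectedComponent.lift f.1 (by
        intro u v p hp
        clear hp
        induction p with
        | nil => rfl
        | cons h p ih =>
          rw [SimpleGraph.fromEdgeSet_adj] at h
          have := f.2 _ h.1
          rw [Sym2.map_mk, Sym2.mk_isDiag_iff] at this
          exact this.trans ih)
      invFun := fun g => ⟨fun v => g ((SimpleGraph.fromEdgeSet A).connectedComponentMk v), by
        intro e he
        induction e with
        | _ u v =>
          rw [Sym2.map_mk, Sym2.mk_isDiag_iff]
          by_cases huv : u = v
          · rw [huv]
          · congr 1
            exact SimpleGraph.ConnectedComponent.sound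
              (SimpleGraph.Adj.reachable ((SimpleGraph.fromEdgeSet_adj A).2 ⟨he, huv⟩))⟩
      left_inv := fun f => rfl
      right_inv := fun g => by
        funext c
        induction c using SimpleGraph.ConnectedComponent.ind with
        | _ v => rfl }
  rw [Nat.card_congr e, Nat.card_fun, Nat.card_fin]

/-- The number of proper colourings of a finite graph with `n` colours is a polynomial in `n`. -/
theorem exists_chromaticPolynomial [Finite V] (G : SimpleGraph V) :
    ∃ P : ℤ[X], ∀ n : ℕ, P.eval (n : ℤ) = (Nat.card (G.Coloring (Fin n)) : ℤ) := by
  classical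
  have := Fintype.ofFinite V
  refine ⟨∑ A ∈ G.edgeFinset.powerset,
    (-1) ^ A.card * X ^ Nat.card (SimpleGraph.fromEdgeSet (A : Set (Sym2 V))).ConnectedComponent,
    fun n => ?_⟩
  have hcol : Nat.card (G.Coloring (Fin n)) =
      Nat.card {f : V → Fin n // ∀ e ∈ G.edgeFinset, ¬ (e.map f).IsDiag} := by
    refine Nat.card_congr
      { toFun := fun c => ⟨c, ?_⟩
        invFun := fun f => SimpleGraph.Coloring.mk f.1 ?_
        left_inv := fun c => ?_
        right_inv := fun f => rfl }
    · intro e he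
      induction e with
      | _ u v =>
        rw [Sym2.map_mk, Sym2.mk_isDiag_iff]
        exact c.valid (by simpa using he)
    · intro u v huv
      have := f.2 s(u, v) (by simpa using huv)
      rwa [Sym2.map_mk, Sym2.mk_isDiag_iff] at this
    · ext v; rfl
  have hind : ∀ f : V → Fin n,
      (if ∀ e ∈ G.edgeFinset, ¬ (e.map f).IsDiag then (1 : ℤ) else 0) =
      ∑ A ∈ G.edgeFinset.powerset,
        (-1) ^ A.card * (if ∀ e ∈ A, (e.map f).IsDiag then (1 : ℤ) else 0) := by
    intro f
    have h1 : (if ∀ e ∈ G.edgeFinset, ¬ (e.map f).IsDiag then (1 : ℤ) else 0) =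
        ∏ e ∈ G.edgeFinset, (1 + (-1) * (if (e.map f).IsDiag then (1 : ℤ) else 0)) := by
      have h2 := Finset.prod_ite_zero (s := G.edgeFinset)
        (p := fun e => ¬ (e.map f).IsDiag) (f := fun _ => (1 : ℤ))
      rw [Finset.prod_const_one] at h2
      refine Eq.trans (by congr) (h2.symm.trans ?_)
      refine Finset.prod_congr rfl fun e _ => ?_
      by_cases h : (e.map f).IsDiag <;> simp [h]
    rw [h1, Finset.prod_one_add]
    refine Finset.sum_congr rfl fun A _ => ?_
    rw [Finset.prod_mul_distrib, Finset.prod_const, Finset.prod_ite_zero, Finset.prod_const_one]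
    congr
  rw [hcol, Nat.card_eq_fintype_card, Fintype.card_subtype, Finset.card_filter]
  push_cast
  rw [Finset.sum_congr rfl (fun f _ => hind f), Finset.sum_comm, Polynomial.eval_finsetSum]
  refine Finset.sum_congr rfl fun A _ => ?_
  rw [← Finset.mul_sum, Finset.sum_boole, ← Fintype.card_subtype, ← Nat.card_eq_fintype_card]
  have := card_monochromatic (A : Set (Sym2 V)) n
  simp only [Finset.mem_coe] at this
  rw [this]
  simp

/-- The chromatic polynomial of a finite graph `G`: the polynomial whose value at each natural
number `n` is the number of proper colourings of `G` with `n` colours. -/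
noncomputable def chromaticPolynomial [Finite V] (G : SimpleGraph V) : ℤ[X] :=
  (exists_chromaticPolynomial G).choose

theorem chromaticPolynomial_eval [Finite V] (G : SimpleGraph V) (n : ℕ) :
    (chromaticPolynomial G).eval (n : ℤ) = (Nat.card (G.Coloring (Fin n)) : ℤ) :=
  (exists_chromaticPolynomial G).choose_spec n

theorem chromaticPolynomial_unique [Finite V] (G : SimpleGraph V) (P : ℤ[X])
    (hP : ∀ n : ℕ, P.eval (n : ℤ) = (Nat.card (G.Coloring (Fin n)) : ℤ)) :
    P = chromaticPolynomial G := by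
  refine Polynomial.eq_of_infinite_eval_eq _ _ (Set.Infinite.mono ?_
    (Set.infinite_range_of_injective (Nat.cast_injective (R := ℤ))))
  rintro _ ⟨n, rfl⟩
  exact (hP n).trans (chromaticPolynomial_eval G n).symm

/-- A chromatic root of `G` is a complex root of its chromatic polynomial. -/
def IsChromaticRoot [Finite V] (G : SimpleGraph V) (z : ℂ) : Prop :=
  aeval z (chromaticPolynomial G) = 0

/-- `chromaticRadius G` is the maximum of `|z - 1|` over the chromatic roots `z` of `G`. -/
noncomputable def chromaticRadius [Finite V] (G : SimpleGraph V) : ℝ :=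
  sSup {r : ℝ | ∃ z : ℂ, IsChromaticRoot G z ∧ r = ‖z - 1‖}

/-- For a graph with at least one vertex the supremum in `chromaticRadius` is a maximum. -/
theorem chromaticRadius_isGreatest [Finite V] [Nonempty V] (G : SimpleGraph V) :
    IsGreatest {r : ℝ | ∃ z : ℂ, IsChromaticRoot G z ∧ r = ‖z - 1‖} (chromaticRadius G) := by
  have hne : chromaticPolynomial G ≠ 0 := by
    intro h
    have h1 := chromaticPolynomial_eval G (Nat.card V)
    rw [h, Polynomial.eval_zero] at h1
    have : Nonempty (G.Coloring (Fin (Nat.card V))) :=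
      ⟨SimpleGraph.Coloring.mk (Finite.equivFin V) fun h e =>
        h.ne ((Finite.equivFin V).injective e)⟩
    have : Finite (G.Coloring (Fin (Nat.card V))) := DFunLike.finite _
    have := Nat.card_pos (α := G.Coloring (Fin (Nat.card V)))
    omega
  have hfin : {z : ℂ | IsChromaticRoot G z}.Finite := by
    refine ((chromaticPolynomial G).rootSet_finite ℂ).subset fun z hz => ?_
    exact (Polynomial.mem_rootSet.2 ⟨hne, hz⟩)
  have hzero : IsChromaticRoot G 0 := by
    have h1 := chromaticPolynomial_eval G 0
    have : IsEmpty (G.Coloring (Fin 0)) := ⟨fun c => (c (Classical.arbitrary V)).elim0⟩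
    rw [Nat.card_of_isEmpty, Nat.cast_zero] at h1
    have h2 := Polynomial.aeval_algebraMap_apply ℂ (0 : ℤ) (chromaticPolynomial G)
    rw [map_zero, Polynomial.coe_aeval_eq_eval, h1, map_zero] at h2
    exact h2
  have himg : {r : ℝ | ∃ z : ℂ, IsChromaticRoot G z ∧ r = ‖z - 1‖} =
      (fun z : ℂ => ‖z - 1‖) '' {z : ℂ | IsChromaticRoot G z} := by
    ext r
    simp only [Set.mem_ofPred_eq, Set.mem_image, eq_comm]
  have hfin' : {r : ℝ | ∃ z : ℂ, IsChromaticRoot G z ∧ r = ‖z - 1‖}.Finite := by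
    rw [himg]
    exact hfin.image _
  exact ⟨Set.Nonempty.csSup_mem ⟨_, 0, hzero, rfl⟩ hfin',
    fun r hr => le_csSup hfin'.bddAbove hr⟩

end ChromaticPolynomial

section ThetaGraph

/-- The vertices of the generalized theta graph with path lengths `s i`: two endvertices
`inl 0`, `inl 1`, and for each `i` the `s i - 1` interior vertices of the `i`-th path. -/
abbrev ThetaVertex {k : ℕ} (s : Fin k → ℕ) : Type :=
  Fin 2 ⊕ (Σ i : Fin k, Fin (s i - 1))

/-- The vertex at position `j` (for `0 ≤ j ≤ s i`) on the `i`-th path. -/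
def thetaPathVertex {k : ℕ} (s : Fin k → ℕ) (i : Fin k) (j : ℕ) : ThetaVertex s :=
  if j = 0 then Sum.inl 0
  else if h : j - 1 < s i - 1 then Sum.inr ⟨i, ⟨j - 1, h⟩⟩
  else Sum.inl 1

/-- The generalized theta graph with path lengths `s i ≥ 1`: two endvertices joined by `k`
internally disjoint paths, the `i`-th of which has `s i` edges. (Repeated paths of length `1` give
the same edge; this does not affect colourings.) -/
def thetaGraph {k : ℕ} (s : Fin k → ℕ) : SimpleGraph (ThetaVertex s) :=
  SimpleGraph.fromRel fun x y =>
    ∃ i : Fin k, ∃ j < s i, x = thetaPathVertex s i j ∧ y = thetaPathVertex s i (j + 1)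

/-- The theta graph made of `k` paths, all of length `s`. -/
abbrev uniformThetaGraph (s k : ℕ) : SimpleGraph (ThetaVertex fun _ : Fin k => s) :=
  thetaGraph fun _ : Fin k => s

end ThetaGraph

/-! Counting colourings of `K_{2,k}` gives the polynomial `z (z-1)^k + z (z-1) (z-2)^k`. Put `L =
log k` and `z - 1 = k / t`; a root with `z ≠ 0, 1` means `(1 - t/k)^k = -t/k`. Taking a `k`-th root,
with `-1 = exp (a * I)` and `a = ±π`, leads to `t = k (1 - exp ((log t - L + a * I) / k))`. To first
order the right side is `L - log t - a * I`, hence about `L - log L - a * I`. Its derivative in `t`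
has norm at most `1 / |t|`, so the contraction principle gives a solution near that point
(`exists_fixedPoint_near`), and expanding `k / t` yields the two roots.

Conversely, any root with `r = |z-1| > 1` satisfies `r^k ≥ r (r-1)^k`, so `(r-1) log r ≤ k`
(`IsChromaticRoot.sub_one_mul_log_le`). This forces `r ≤ (1 + o(1)) k / log k`, which the two roots
attain. -/

/-! ### The chromatic polynomial of `K_{2,k}` -/

/-- The theta graph made of `k` paths of length two is the complete bipartite graph `K_{2,k}`. -/
def uniformThetaGraphTwoIso (k : ℕ) :
    uniformThetaGraph 2 k ≃g completeBipartiteGraph (Fin 2) (Fin k) where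
  toFun := Sum.map id Sigma.fst
  invFun := Sum.map id fun i => ⟨i, ⟨0, Nat.one_pos⟩⟩
  left_inv := by
    rintro (a | ⟨i, j⟩)
    · rfl
    · obtain ⟨j, hj⟩ := j
      obtain rfl : j = 0 := Nat.lt_one_iff.1 hj
      rfl
  right_inv := by rintro (a | i) <;> rfl
  map_rel_iff' := by
    have h0 (i : Fin k) : thetaPathVertex (fun _ : Fin k => 2) i 0 = Sum.inl 0 := rfl
    have h1 (i : Fin k) : thetaPathVertex (fun _ : Fin k => 2) i 1 =
      Sum.inr ⟨i, ⟨0, Nat.one_pos⟩⟩ := rfl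
    have h2 (i : Fin k) : thetaPathVertex (fun _ : Fin k => 2) i 2 = Sum.inl 1 := rfl
    have key (x y : ThetaVertex fun _ : Fin k => 2) :
        (∃ i : Fin k, ∃ j < 2, x = thetaPathVertex (fun _ : Fin k => 2) i j ∧
          y = thetaPathVertex (fun _ : Fin k => 2) i (j + 1)) ↔
        ∃ i : Fin k, (x = Sum.inl 0 ∧ y = Sum.inr ⟨i, ⟨0, Nat.one_pos⟩⟩) ∨
          (x = Sum.inr ⟨i, ⟨0, Nat.one_pos⟩⟩ ∧ y = Sum.inl 1) := by
      refine exists_congr fun i => ⟨?_, ?_⟩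
      · rintro ⟨j, hj, hx, hy⟩
        interval_cases j
        · exact Or.inl ⟨hx, hy⟩
        · exact Or.inr ⟨hx, hy⟩
      · rintro (h | h)
        · exact ⟨0, by norm_num, h⟩
        · exact ⟨1, by norm_num, h⟩
    intro x y
    simp only [uniformThetaGraph, thetaGraph, SimpleGraph.fromRel_adj, key]
    rcases x with a | ⟨i, ⟨j, hj⟩⟩ <;> rcases y with b | ⟨i', ⟨j', hj'⟩⟩
    · simp
    · obtain rfl : j' = 0 := Nat.lt_one_iff.1 hj'
      fin_cases a <;> simp
    · obtain rfl : j = 0 := Nat.lt_one_iff.1 hj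
      fin_cases b <;> simp
    · simp

theorem card_ne_and_ne {n : ℕ} (a b : Fin n) :
    Fintype.card {c : Fin n // c ≠ a ∧ c ≠ b} = if a = b then n - 1 else n - 2 := by
  rw [Fintype.card_subtype]
  have : (Finset.univ.filter fun c : Fin n => c ≠ a ∧ c ≠ b) = ({a, b} : Finset (Fin n))ᶜ := by
    ext c; simp
  rw [this, Finset.card_compl, Fintype.card_fin]
  split_ifs with h
  · simp [h]
  · rw [Finset.card_pair h]

/-- A colouring of `K_{2,k}` is a pair of colours for the first part together with a choice, for
each vertex of the second part, of a colour that differs from both. -/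
def completeBipartiteColoringEquiv (k n : ℕ) :
    (completeBipartiteGraph (Fin 2) (Fin k)).Coloring (Fin n) ≃
      Σ p : Fin n × Fin n, (Fin k → {c : Fin n // c ≠ p.1 ∧ c ≠ p.2}) where
  toFun f := ⟨(f (Sum.inl 0), f (Sum.inl 1)), fun i => ⟨f (Sum.inr i),
    f.valid (by simp), f.valid (by simp)⟩⟩
  invFun g := SimpleGraph.Coloring.mk
    (Sum.elim (fun a => if a = 0 then g.1.1 else g.1.2) fun i => (g.2 i).1) (by
      rintro (a | i) (b | j) h
      · simp at h
      · have := (g.2 j).2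
        simp only [Sum.elim_inl, Sum.elim_inr]
        split_ifs
        exacts [this.1.symm, this.2.symm]
      · have := (g.2 i).2
        simp only [Sum.elim_inl, Sum.elim_inr]
        split_ifs
        exacts [this.1, this.2]
      · simp at h)
  left_inv f := by
    ext x : 1
    rcases x with a | i
    · fin_cases a <;> rfl
    · rfl
  right_inv g := rfl

theorem card_completeBipartite_coloring (k n : ℕ) :
    (Nat.card ((completeBipartiteGraph (Fin 2) (Fin k)).Coloring (Fin n)) : ℤ) =
      n * (n - 1) ^ k + n * (n - 1) * (n - 2) ^ k := by
  rw [Nat.card_congr (completeBipartiteColoringEquiv k n), Nat.card_eq_fintype_card,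
    Fintype.card_sigma]
  simp only [Fintype.card_fun, Fintype.card_fin, card_ne_and_ne, Fintype.sum_prod_type]
  have h (a : Fin n) : ∑ b : Fin n, (if a = b then n - 1 else n - 2) ^ k =
      (n - 1) ^ k + (n - 1) * (n - 2) ^ k := by
    rw [← Finset.add_sum_erase _ _ (Finset.mem_univ a), if_pos rfl]
    congr 1
    rw [Finset.sum_congr rfl (g := fun _ => (n - 2) ^ k)
      fun b hb => by rw [if_neg (Finset.ne_of_mem_erase hb).symm]]
    simp
  simp only [h, Finset.sum_const, Finset.card_univ, Fintype.card_fin, smul_eq_mul]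
  -- The truncated `n - 1` and `n - 2` differ from the integer ones only for `n ≤ 1`, where a factor
  -- `n` or `n - 1` kills the discrepancy.
  rcases n with _ | _ | n
  · simp
  · simp
  · rw [show n + 1 + 1 - 2 = n by omega, show n + 1 + 1 - 1 = n + 1 by omega]
    push_cast
    rw [show (n : ℤ) + 1 + 1 - 1 = n + 1 by ring, show (n : ℤ) + 1 + 1 - 2 = n by ring]
    ring

theorem chromaticPolynomial_uniformThetaGraph_two (k : ℕ) :
    chromaticPolynomial (uniformThetaGraph 2 k) =
      X * (X - 1) ^ k + X * (X - 1) * (X - 2) ^ k := by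
  refine (chromaticPolynomial_unique _ _ fun n => ?_).symm
  have e : (uniformThetaGraph 2 k).Coloring (Fin n) ≃
      (completeBipartiteGraph (Fin 2) (Fin k)).Coloring (Fin n) :=
    { toFun := fun f => f.comp (uniformThetaGraphTwoIso k).symm.toHom
      invFun := fun f => f.comp (uniformThetaGraphTwoIso k).toHom
      left_inv := fun f => by
        ext x : 1
        exact congrArg f ((uniformThetaGraphTwoIso k).symm_apply_apply x)
      right_inv := fun f => by
        ext x : 1
        exact congrArg f ((uniformThetaGraphTwoIso k).apply_symm_apply x) }
  rw [Nat.card_congr e, card_completeBipartite_coloring]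
  simp

theorem isChromaticRoot_uniformThetaGraph_two {k : ℕ} {z : ℂ} :
    IsChromaticRoot (uniformThetaGraph 2 k) z ↔
      z * (z - 1) ^ k + z * (z - 1) * (z - 2) ^ k = 0 := by
  rw [IsChromaticRoot, chromaticPolynomial_uniformThetaGraph_two]
  simp [map_ofNat (aeval z)]

/-! ### Roots from a fixed point equation -/

/-- The centre lies within `log L + 4` of `L` and the radius is `1`; the constant `5` is absorbed
using `log L ≥ 1`. -/
theorem norm_sub_log_le {L a : ℝ} (hℓ : 1 ≤ Real.log L)
    (ha : |a| ≤ 4) {t : ℂ} (ht : ‖t - (L - Real.log L - a * Complex.I)‖ ≤ 1) :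
    ‖t - L‖ ≤ 6 * Real.log L := by
  have h : t - L = (t - (L - Real.log L - a * Complex.I)) +
      (-((Real.log L : ℝ) : ℂ) - ((a : ℝ) : ℂ) * Complex.I) := by ring
  rw [h]
  refine (norm_add_le _ _).trans ?_
  have := norm_sub_le (-((Real.log L : ℝ) : ℂ)) (((a : ℝ) : ℂ) * Complex.I)
  rw [norm_neg, norm_mul, Complex.norm_I, Complex.norm_real, Complex.norm_real, Real.norm_eq_abs,
    Real.norm_eq_abs, abs_of_pos (by linarith : 0 < Real.log L)] at this
  linarith

/-- Near the point `L - log L - a * I` the function `log` is close to `log L`. -/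
theorem norm_log_sub_log_le {L a : ℝ} (hℓ : 1 ≤ Real.log L) (hL : 12 * Real.log L ≤ L)
    (ha : |a| ≤ 4) {t : ℂ} (ht : ‖t - (L - Real.log L - a * Complex.I)‖ ≤ 1) :
    ‖Complex.log t - Real.log L‖ ≤ 9 * Real.log L / L := by
  have hL0 : 0 < L := by linarith
  have hLc : (L : ℂ) ≠ 0 := by exact_mod_cast hL0.ne'
  have h1 := norm_sub_log_le hℓ ha ht
  set x : ℂ := (t - L) / L with hx
  have hxn : ‖x‖ ≤ 6 * Real.log L / L := by
    rw [hx, norm_div, Complex.norm_real, Real.norm_eq_abs, abs_of_pos hL0]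
    gcongr
  -- The factor `12` in `hL` is what puts `x` in the range where `‖log (1 + x)‖ ≤ 3/2 ‖x‖`.
  have hx2 : ‖x‖ ≤ 1 / 2 := hxn.trans (by rw [div_le_iff₀ hL0]; linarith)
  have hne : 1 + x ≠ 0 := fun h => by
    have : x = -1 := by linear_combination h
    rw [this] at hx2
    norm_num at hx2
  have htx : t = L * (1 + x) := by rw [hx]; field_simp; ring
  rw [htx, Complex.log_ofReal_mul hL0 hne, add_sub_cancel_left]
  refine (Complex.norm_log_one_add_half_le_self hx2).trans ?_
  calc 3 / 2 * ‖x‖ ≤ 3 / 2 * (6 * Real.log L / L) := by gcongr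
    _ = 9 * Real.log L / L := by ring

/-- The fixed point equation `t = k (1 - exp ((log t - L + a * I) / k))` has a solution close to
`L - log L - a * I`. -/
theorem exists_fixedPoint_near {L a k : ℝ} (hℓ : 1 ≤ Real.log L) (hL : 12 * Real.log L ≤ L)
    (ha : |a| ≤ 4) (hk : 4 * L ^ 3 ≤ k) :
    ∃ t : ℂ, t = k * (1 - Complex.exp ((Complex.log t - L + a * Complex.I) / k)) ∧
      ‖t - (L - Real.log L - a * Complex.I)‖ ≤ 10 * Real.log L / L := by
  have hL0 : 0 < L := by linarith
  have hL12 : 12 ≤ L := by linarith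
  have hk0 : 0 < k := lt_of_lt_of_le (by positivity) hk
  have hkc : (k : ℂ) ≠ 0 := by exact_mod_cast hk0.ne'
  set c : ℂ := L - Real.log L - a * Complex.I with hc
  have hr1 : 10 * Real.log L / L ≤ 1 := by rw [div_le_one hL0]; linarith
  set z : ℂ → ℂ := fun t => (Complex.log t - L + a * Complex.I) / k with hz
  set F : ℂ → ℂ := fun t => k * (1 - Complex.exp (z t)) with hF
  have hkz (t : ℂ) : k * z t = -c + (Complex.log t - Real.log L) := by
    simp only [hz, hc]
    field_simp
    ring
  have h9 : 9 * Real.log L / L ≤ 3 / 4 := by rw [div_le_iff₀ hL0]; linarith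
  have hcn : ‖c‖ ≤ L + 4 := by
    have h1 : c = ((L - Real.log L : ℝ) : ℂ) - (a : ℂ) * Complex.I := by rw [hc]; push_cast; ring
    have := norm_sub_le ((L - Real.log L : ℝ) : ℂ) ((a : ℂ) * Complex.I)
    rw [← h1, norm_mul, Complex.norm_I, Complex.norm_real, Complex.norm_real, Real.norm_eq_abs,
      Real.norm_eq_abs, abs_of_pos (by linarith : 0 < L - Real.log L)] at this
    linarith
  have hkzn (t : ℂ) (ht : ‖t - c‖ ≤ 1) : k * ‖z t‖ ≤ 2 * L := by
    have h1 : ‖(k : ℂ) * z t‖ ≤ ‖c‖ + ‖Complex.log t - Real.log L‖ := by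
      rw [hkz]
      exact (norm_add_le _ _).trans (by rw [norm_neg])
    rw [norm_mul, Complex.norm_real, Real.norm_eq_abs, abs_of_pos hk0] at h1
    have := norm_log_sub_log_le hℓ hL ha ht
    linarith
  have hdist (t : ℂ) (ht : ‖t - c‖ ≤ 1) : ‖F t - c‖ ≤ 10 * Real.log L / L := by
    -- Two errors: the quadratic remainder of `exp`, at most `4 L^2 / k ≤ 1 / L` because `k ≥ 4
    -- L^3`, and the replacement of `log t` by `log L`. They account for `1 + 9 = 10`.
    have h1 : F t - c = -(k * (Complex.exp (z t) - 1 - z t)) - (Complex.log t - Real.log L) := by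
      have := hkz t
      simp only [hF]
      linear_combination -this
    have h2 := hkzn t ht
    have h3 : ‖z t‖ ≤ 2 * L / k := by rw [le_div_iff₀ hk0]; linarith
    have h4 : 2 * L / k ≤ 1 := by
      rw [div_le_one hk0]
      nlinarith [mul_pos hL0 hL0]
    have h5 := Complex.norm_exp_sub_one_sub_id_le (h3.trans h4)
    have h6 : k * ‖Complex.exp (z t) - 1 - z t‖ ≤ Real.log L / L := by
      calc k * ‖Complex.exp (z t) - 1 - z t‖ ≤ k * (2 * L / k) ^ 2 := by
            gcongr
            exact h5.trans (by gcongr)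
        _ = 4 * L ^ 2 / k := by field_simp; ring
        _ ≤ 4 * L ^ 2 / (4 * L ^ 3) := by gcongr
        _ = 1 / L := by field_simp
        _ ≤ Real.log L / L := by gcongr
    have h7 := norm_log_sub_log_le hℓ hL ha ht
    rw [h1]
    refine (norm_sub_le _ _).trans ?_
    rw [norm_neg, norm_mul, Complex.norm_real, Real.norm_eq_abs, abs_of_pos hk0]
    calc _ ≤ Real.log L / L + 9 * Real.log L / L := add_le_add h6 h7
      _ = _ := by ring
  have hre (t : ℂ) (ht : ‖t - c‖ ≤ 1) : L / 2 ≤ t.re := by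
    have h1 := (Complex.abs_re_le_norm _).trans (norm_sub_log_le hℓ ha ht)
    rw [Complex.sub_re, Complex.ofReal_re, abs_le] at h1
    linarith
  have hder (t : ℂ) (ht : ‖t - c‖ ≤ 1) : HasDerivAt F (-Complex.exp (z t) / t) t := by
    have hslit : t ∈ Complex.slitPlane := Or.inl (by have := hre t ht; linarith)
    have := ((((((Complex.hasDerivAt_log hslit).sub_const (L : ℂ)).add_const
      (a * Complex.I)).div_const (k : ℂ)).cexp.const_sub 1).const_mul (k : ℂ))
    refine HasDerivAt.congr_deriv this ?_
    have := Complex.slitPlane_ne_zero hslit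
    simp only [hz]
    field_simp
  -- The real part of `k * z t` is `-(L - log L)` up to an error of at most `3/4`, so the
  -- exponential has norm at most `1`, while `|t| ≥ L / 2`.
  have hbound (t : ℂ) (ht : ‖t - c‖ ≤ 1) : ‖-Complex.exp (z t) / t‖ ≤ 1 / 2 := by
    have h1 : (z t).re ≤ 0 := by
      have h2 := congrArg Complex.re (hkz t)
      rw [Complex.re_ofReal_mul, Complex.add_re, Complex.neg_re] at h2
      have h3 := (Complex.re_le_norm _).trans (norm_log_sub_log_le hℓ hL ha ht)
      have h4 : c.re = L - Real.log L := by simp [hc]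
      rw [h4] at h2
      by_contra! h
      have := mul_pos hk0 h
      linarith
    have h2 : 2 ≤ ‖t‖ := by
      have := (hre t ht).trans (Complex.re_le_norm t)
      linarith
    rw [norm_div, norm_neg, Complex.norm_exp]
    exact div_le_div₀ zero_le_one (Real.exp_le_one_iff.2 h1) two_pos h2
  have hmaps : Set.MapsTo F (Metric.closedBall c 1) (Metric.closedBall c 1) := fun t ht => by
    rw [mem_closedBall_iff_norm] at ht ⊢
    exact (hdist t ht).trans hr1
  have hlip : LipschitzOnWith (1 / 2) F (Metric.closedBall c 1) := by
    refine (convex_closedBall c 1).lipschitzOnWith_of_nnnorm_hasDerivWithin_le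
      (fun t ht => (hder t (mem_closedBall_iff_norm.1 ht)).hasDerivWithinAt) fun t ht => ?_
    rw [← NNReal.coe_le_coe, coe_nnnorm]
    exact (hbound t (mem_closedBall_iff_norm.1 ht)).trans (by norm_num)
  have hcontr : ContractingWith (1 / 2) (hmaps.restrict F _ _) :=
    ⟨by rw [← NNReal.coe_lt_coe]; norm_num, hlip.mapsToRestrict hmaps⟩
  obtain ⟨t, ht, hfix, -⟩ := hcontr.exists_fixedPoint' (x := c)
    Metric.isClosed_closedBall.isComplete hmaps (Metric.mem_closedBall_self zero_le_one)
    (edist_ne_top _ _)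
  refine ⟨t, hfix.eq.symm, ?_⟩
  have := hdist t (mem_closedBall_iff_norm.1 ht)
  rwa [hfix.eq] at this

/-- A nonzero solution of the fixed point equation gives a chromatic root of `Θ^{(2,k)}`. -/
theorem isChromaticRoot_of_fixedPoint {k : ℕ} (hk : k ≠ 0) {a : ℝ}
    (ha : Complex.exp (a * Complex.I) = -1) {t : ℂ} (ht0 : t ≠ 0)
    (ht : t = (k : ℝ) * (1 - Complex.exp ((Complex.log t - (Real.log k : ℝ) + a * Complex.I) /
      (k : ℝ)))) :
    IsChromaticRoot (uniformThetaGraph 2 k) (k / t + 1) := by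
  have hkc : (k : ℂ) ≠ 0 := by exact_mod_cast hk
  set E := Complex.exp ((Complex.log t - (Real.log k : ℝ) + a * Complex.I) / (k : ℝ)) with hE
  have h1 : E ^ k = -(t / k) := by
    rw [hE, ← Complex.exp_nat_mul, Complex.ofReal_natCast, mul_div_cancel₀ _ hkc, Complex.exp_add,
      Complex.exp_sub, ha, Complex.exp_log ht0, Complex.ofReal_log (Nat.cast_nonneg k),
      Complex.ofReal_natCast, Complex.exp_log hkc]
    ring
  -- The fixed point equation says `E = 1 - t / k`, which turns `z - 2` into `(z - 1) * E`.
  have h2 : (k : ℂ) / t + 1 - 2 = k / t * E := by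
    rw [Complex.ofReal_natCast] at ht
    have : E = 1 - t / k := by
      rw [eq_sub_iff_add_eq, add_comm, ← eq_sub_iff_add_eq, div_eq_iff hkc]
      linear_combination ht
    rw [this]
    field_simp
    ring
  rw [isChromaticRoot_uniformThetaGraph_two, h2, mul_pow, h1, add_sub_cancel_right]
  field_simp
  ring

/-- With `t = L - log L - a * I + δ`, the first-order terms in `a` cancel, leaving the numerator
`-(δ + a * I * (t - L) / L)`. Its parts contribute `10` and `24`, and `|t| ≥ L / 2` doubles the sum
to `68`. -/
theorem norm_div_sub_one_sub_le {L a : ℝ} (hℓ : 1 ≤ Real.log L) (hL : 12 * Real.log L ≤ L)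
    (ha : |a| ≤ 4) {t : ℂ}
    (ht : ‖t - (L - Real.log L - a * Complex.I)‖ ≤ 10 * Real.log L / L) :
    t ≠ 0 ∧ ‖((L - Real.log L : ℝ) : ℂ) / t - 1 - a * Complex.I / L‖ ≤
      68 * (Real.log L / L ^ 2) := by
  have hL0 : 0 < L := by linarith
  have hLc : (L : ℂ) ≠ 0 := by exact_mod_cast hL0.ne'
  have h1 := norm_sub_log_le hℓ ha (ht.trans (by rw [div_le_one hL0]; linarith))
  have h2 : L / 2 ≤ ‖t‖ := by
    have := norm_sub_norm_le (L : ℂ) t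
    rw [norm_sub_rev, Complex.norm_real, Real.norm_eq_abs, abs_of_pos hL0] at this
    linarith
  have ht0 : t ≠ 0 := norm_pos_iff.1 (by linarith)
  refine ⟨ht0, ?_⟩
  have h3 : ((L - Real.log L : ℝ) : ℂ) / t - 1 - a * Complex.I / L =
      -((t - (L - Real.log L - a * Complex.I)) + (a : ℂ) * Complex.I * (t - L) / L) / t := by
    push_cast
    field_simp
    ring
  have h4 : ‖(a : ℂ) * Complex.I * (t - L) / L‖ ≤ 24 * Real.log L / L := by
    rw [norm_div, norm_mul, norm_mul, Complex.norm_I, Complex.norm_real, Complex.norm_real,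
      Real.norm_eq_abs, Real.norm_eq_abs, abs_of_pos hL0, mul_one]
    calc |a| * ‖t - L‖ / L ≤ 4 * (6 * Real.log L) / L := by gcongr
      _ = 24 * Real.log L / L := by ring
  rw [h3, norm_div, norm_neg]
  calc _ ≤ (10 * Real.log L / L + 24 * Real.log L / L) / (L / 2) := by
        gcongr
        exact (norm_add_le _ _).trans (add_le_add ht h4)
    _ = 68 * (Real.log L / L ^ 2) := by field_simp; ring

/-! ### Asymptotics as `k → ∞` -/

theorem tendsto_log_natCast : Tendsto (fun k : ℕ => Real.log k) atTop atTop :=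
  Real.tendsto_log_atTop.comp tendsto_natCast_atTop_atTop

theorem tendsto_log_natCast_div : Tendsto (fun k : ℕ => Real.log k / k) atTop (𝓝 0) :=
  Real.isLittleO_log_id_atTop.tendsto_div_nhds_zero.comp tendsto_natCast_atTop_atTop

theorem tendsto_log_log_natCast_div :
    Tendsto (fun k : ℕ => Real.log (Real.log k) / Real.log k) atTop (𝓝 0) :=
  Real.isLittleO_log_id_atTop.tendsto_div_nhds_zero.comp tendsto_log_natCast

theorem tendsto_log_log_natCast_div_sq :
    Tendsto (fun k : ℕ => Real.log (Real.log k) / Real.log k ^ 2) atTop (𝓝 0) := by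
  have := tendsto_log_log_natCast_div.mul (tendsto_inv_atTop_zero.comp tendsto_log_natCast)
  rw [zero_mul] at this
  refine this.congr fun k => ?_
  simp only [Function.comp_apply]
  ring

/-- Supplies the thresholds of the fixed point argument at `L = log k`. -/
theorem eventually_log_natCast :
    ∀ᶠ k : ℕ in atTop, k ≠ 0 ∧ 1 ≤ Real.log (Real.log k) ∧
      12 * Real.log (Real.log k) ≤ Real.log k ∧ 4 * Real.log k ^ 3 ≤ k := by
  have h1 := (Real.tendsto_log_atTop.comp tendsto_log_natCast).eventually_ge_atTop 1
  have h2 := tendsto_log_log_natCast_div.eventually_le_const (by norm_num : (0 : ℝ) < 1 / 12)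
  have h3 := ((Real.isLittleO_pow_log_id_atTop (n := 3)).tendsto_div_nhds_zero.comp
    (tendsto_natCast_atTop_atTop (R := ℝ))).eventually_le_const (by norm_num : (0 : ℝ) < 1 / 4)
  filter_upwards [h1, h2, h3, eventually_ne_atTop 0, tendsto_log_natCast.eventually_gt_atTop 0]
    with k h1 h2 h3 h4 h5
  have h6 : (0 : ℝ) < k := by positivity
  simp only [Function.comp_apply, id] at h1 h3
  rw [div_le_iff₀ h5] at h2
  rw [div_le_iff₀ h6] at h3
  exact ⟨h4, h1, by linarith, by linarith⟩

/-- For `a = ±π` the graphs `Θ^{(2,k)}` have chromatic roots with the expansion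
`k / (log k - log log k) * (1 + a * I / log k + O(log log k / log ^ 2 k))`. -/
theorem exists_chromaticRoot_expansion {a : ℝ} (ha : |a| ≤ 4)
    (hexp : Complex.exp (a * Complex.I) = -1) :
    ∃ z ε : ℕ → ℂ, (∀ᶠ k : ℕ in atTop, IsChromaticRoot (uniformThetaGraph 2 k) (z k) ∧
        z k = (k : ℂ) / ((Real.log k - Real.log (Real.log k) : ℝ) : ℂ) *
          (1 + (a : ℂ) * Complex.I / (Real.log k : ℂ) + ε k) ∧
        ‖ε k‖ ≤ 69 * (Real.log (Real.log k) / Real.log k ^ 2)) := by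
  have h : ∀ᶠ k : ℕ in atTop, ∃ p : ℂ × ℂ, IsChromaticRoot (uniformThetaGraph 2 k) p.1 ∧
        p.1 = (k : ℂ) / ((Real.log k - Real.log (Real.log k) : ℝ) : ℂ) *
          (1 + (a : ℂ) * Complex.I / (Real.log k : ℂ) + p.2) ∧
        ‖p.2‖ ≤ 69 * (Real.log (Real.log k) / Real.log k ^ 2) := by
    filter_upwards [eventually_log_natCast] with k ⟨hk, hℓ, hL, hk3⟩
    set L := Real.log k with hLdef
    have hL0 : 0 < L := by linarith
    have hkc : (k : ℂ) ≠ 0 := by exact_mod_cast hk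
    have hM0 : 0 < L - Real.log L := by linarith
    have hMc : ((L - Real.log L : ℝ) : ℂ) ≠ 0 := by exact_mod_cast hM0.ne'
    obtain ⟨t, hfix, htn⟩ := exists_fixedPoint_near hℓ hL ha hk3
    obtain ⟨ht0, htexp⟩ := norm_div_sub_one_sub_le hℓ hL ha htn
    -- The summand `1` of `z = k / t + 1` becomes `(L - log L) / k` inside the bracket; it costs one
    -- more unit, `68 + 1 = 69`.
    refine ⟨(k / t + 1, (((L - Real.log L : ℝ) : ℂ) / t - 1 - a * Complex.I / L) +
      ((L - Real.log L : ℝ) : ℂ) / k), isChromaticRoot_of_fixedPoint hk hexp ht0 hfix, ?_, ?_⟩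
    · field_simp
      ring
    · refine (norm_add_le _ _).trans ?_
      have h1 : ‖((L - Real.log L : ℝ) : ℂ) / k‖ ≤ Real.log L / L ^ 2 := by
        rw [norm_div, Complex.norm_real, Complex.norm_natCast, Real.norm_eq_abs, abs_of_pos hM0]
        calc (L - Real.log L) / k ≤ L / (4 * L ^ 3) := by
              gcongr
              linarith
          _ = 1 / 4 / L ^ 2 := by field_simp
          _ ≤ Real.log L / L ^ 2 := by
              gcongr
              linarith
      linarith
  obtain ⟨p, hp⟩ := h.choice
  exact ⟨fun k => (p k).1, fun k => (p k).2, hp⟩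

/-- The quotient before taking norms is `(1 - log L / L)⁻¹ (1 + a * I / L + ε) - L / k` with `L =
log k`. -/
theorem tendsto_norm_sub_one_div {a : ℝ} {z ε : ℕ → ℂ} (hε : Tendsto ε atTop (𝓝 0))
    (hz : ∀ᶠ k : ℕ in atTop,
      z k = (k : ℂ) / ((Real.log k - Real.log (Real.log k) : ℝ) : ℂ) *
          (1 + (a : ℂ) * Complex.I / (Real.log k : ℂ) + ε k)) :
    Tendsto (fun k : ℕ => ‖z k - 1‖ / ((k : ℝ) / Real.log k)) atTop (𝓝 1) := by
  have h1 : Tendsto (fun k : ℕ => ((1 - Real.log (Real.log k) / Real.log k : ℝ) : ℂ)⁻¹)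
      atTop (𝓝 1) := by
    have := ((Complex.continuous_ofReal.tendsto _).comp
      (tendsto_log_log_natCast_div.const_sub 1)).inv₀ (by simp)
    simpa using this
  have h2 : Tendsto (fun k : ℕ => (a : ℂ) * Complex.I * ((Real.log k)⁻¹ : ℝ)) atTop (𝓝 0) := by
    have := ((Complex.continuous_ofReal.tendsto _).comp
      (tendsto_inv_atTop_zero.comp tendsto_log_natCast)).const_mul ((a : ℂ) * Complex.I)
    simpa using this
  have h3 : Tendsto (fun k : ℕ => ((Real.log k / k : ℝ) : ℂ)) atTop (𝓝 0) := by
    exact Complex.ofReal_zero ▸ (Complex.continuous_ofReal.tendsto _).comp tendsto_log_natCast_div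
  have h4 := ((h1.mul ((h2.const_add 1).add hε)).sub h3).norm
  simp only [add_zero, mul_one, sub_zero, norm_one] at h4
  refine h4.congr' ?_
  filter_upwards [hz, eventually_log_natCast] with k hk ⟨hk0, hℓ, hL, _⟩
  have hL0 : 0 < Real.log k := by linarith
  have hkc : (k : ℂ) ≠ 0 := by exact_mod_cast hk0
  have hLc : ((Real.log k : ℝ) : ℂ) ≠ 0 := by exact_mod_cast hL0.ne'
  have hMc : ((Real.log k : ℝ) : ℂ) - ((Real.log (Real.log k) : ℝ) : ℂ) ≠ 0 := by
    rw [← Complex.ofReal_sub]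
    exact_mod_cast (by linarith : 0 < Real.log k - Real.log (Real.log k)).ne'
  have h5 : ((k : ℝ) / Real.log k) = ‖((k : ℂ) / (Real.log k : ℝ))‖ := by
    rw [norm_div, Complex.norm_natCast, Complex.norm_real, Real.norm_eq_abs, abs_of_pos hL0]
  rw [h5, ← norm_div, hk]
  congr 1
  have h6 : (1 : ℂ) - (Real.log (Real.log k) : ℝ) / (Real.log k : ℝ) =
      (((Real.log k : ℝ) : ℂ) - ((Real.log (Real.log k) : ℝ) : ℂ)) / (Real.log k : ℝ) := by
    field_simp
  simp only [Complex.ofReal_sub, Complex.ofReal_div, Complex.ofReal_inv, Complex.ofReal_one,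
    Complex.ofReal_natCast, h6]
  field_simp

/-! ### Upper bound for all roots -/

/-- Every chromatic root `z` of `Θ^{(2,k)}` with `r = |z - 1| > 1` satisfies
`(r - 1) log r ≤ k`. -/
theorem IsChromaticRoot.sub_one_mul_log_le {k : ℕ} {z : ℂ}
    (hz : IsChromaticRoot (uniformThetaGraph 2 k) z) (hr : 1 < ‖z - 1‖) :
    (‖z - 1‖ - 1) * Real.log ‖z - 1‖ ≤ k := by
  rw [isChromaticRoot_uniformThetaGraph_two] at hz
  have hz0 : z ≠ 0 := by rintro rfl; norm_num at hr
  have h1 : (z - 1) ^ k = -((z - 1) * (z - 2) ^ k) := by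
    refine mul_left_cancel₀ hz0 ?_
    linear_combination hz
  have h2 := congrArg norm h1
  rw [norm_neg, norm_mul, norm_pow, norm_pow] at h2
  set r := ‖z - 1‖ with hrdef
  have h3 : r - 1 ≤ ‖z - 2‖ := by
    have := norm_sub_norm_le (z - 1) 1
    rwa [norm_one, show z - 1 - 1 = z - 2 by ring] at this
  have hr0 : 0 < r := by linarith
  have hr1 : 0 < r - 1 := by linarith
  have h4 : r * (r - 1) ^ k ≤ r ^ k := by
    rw [h2]
    gcongr
  have h5 := Real.log_le_log (by positivity) h4
  rw [Real.log_mul (by positivity) (by positivity), Real.log_pow, Real.log_pow] at h5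
  -- The logarithms in `h5` give `log r ≤ k log (r / (r - 1))`; now `log x ≤ x - 1`.
  have h6 := Real.log_le_sub_one_of_pos (div_pos hr0 hr1)
  rw [Real.log_div hr0.ne' hr1.ne', show r / (r - 1) - 1 = 1 / (r - 1) by field_simp; ring] at h6
  have h7 : Real.log r ≤ k * (1 / (r - 1)) :=
    le_trans (by linarith) (mul_le_mul_of_nonneg_left h6 (Nat.cast_nonneg k))
  rw [mul_one_div, le_div_iff₀ hr1] at h7
  linarith

/-- A root with `r ≥ b k / L`, where `L = log k`, has `log r ≥ L - log L`, so `(r - 1) log r ≤ k`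
would give `(b - L / k) (1 - log L / L) ≤ 1`, although the left side tends to `b > 1`. -/
theorem eventually_chromaticRadius_lt {b : ℝ} (hb : 1 < b) :
    ∀ᶠ k : ℕ in atTop,
      chromaticRadius (uniformThetaGraph 2 k) / ((k : ℝ) / Real.log k) < b := by
  have h1 : Tendsto (fun k : ℕ => (b - Real.log k / k) *
      (1 - Real.log (Real.log k) / Real.log k)) atTop (𝓝 b) := by
    simpa using (tendsto_log_natCast_div.const_sub b).mul (tendsto_log_log_natCast_div.const_sub 1)
  filter_upwards [h1.eventually_const_lt hb, eventually_log_natCast] with k h1 ⟨hk0, hℓ, hL, hk⟩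
  obtain ⟨z, hz, hρ⟩ := (chromaticRadius_isGreatest (uniformThetaGraph 2 k)).1
  set L := Real.log k with hLdef
  have hL0 : 0 < L := by linarith
  have hk0' : (0 : ℝ) < k := by positivity
  by_contra! hle
  rw [hρ, le_div_iff₀ (by positivity)] at hle
  have h2 : k / L < ‖z - 1‖ :=
    lt_of_lt_of_le (lt_mul_of_one_lt_left (by positivity) hb) hle
  have h3 : 1 < k / L := by
    rw [one_lt_div hL0]
    have : 1 ≤ L ^ 2 := one_le_pow₀ (by linarith)
    nlinarith
  have h4 := hz.sub_one_mul_log_le (h3.trans h2)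
  have h5 : L - Real.log L ≤ Real.log ‖z - 1‖ := by
    rw [hLdef, ← Real.log_div hk0'.ne' hL0.ne']
    exact Real.log_le_log (by positivity) h2.le
  have h6 : (b * (k / L) - 1) * (L - Real.log L) ≤ k :=
    le_trans (mul_le_mul (by linarith) h5 (by linarith) (by linarith)) h4
  have h7 : (b * (k / L) - 1) * (L - Real.log L) =
      k * ((b - L / k) * (1 - Real.log L / L)) := by
    field_simp
  rw [h7] at h6
  have := (mul_lt_mul_iff_right₀ hk0').2 h1
  linarith

/-! ### The main theorem -/

theorem corollary5p2 :
    (∀ k : ℕ, Nonempty (uniformThetaGraph 2 k ≃g completeBipartiteGraph (Fin 2) (Fin k))) ∧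
    (∃ zp zm εp εm : ℕ → ℂ,
      (∀ᶠ k : ℕ in atTop,
        IsChromaticRoot (uniformThetaGraph 2 k) (zp k) ∧
        IsChromaticRoot (uniformThetaGraph 2 k) (zm k) ∧
        zp k ≠ zm k ∧
        zp k = (k : ℂ) / ((Real.log k - Real.log (Real.log k) : ℝ) : ℂ) *
          (1 + (Real.pi : ℂ) * Complex.I / (Real.log k : ℂ) + εp k) ∧
        zm k = (k : ℂ) / ((Real.log k - Real.log (Real.log k) : ℝ) : ℂ) *
          (1 - (Real.pi : ℂ) * Complex.I / (Real.log k : ℂ) + εm k)) ∧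
      εp =O[atTop] (fun k : ℕ => Real.log (Real.log k) / Real.log k ^ 2) ∧
      εm =O[atTop] (fun k : ℕ => Real.log (Real.log k) / Real.log k ^ 2) ∧
      Tendsto (fun k : ℕ => ‖zp k - 1‖ / ((k : ℝ) / Real.log k)) atTop (𝓝 1) ∧
      Tendsto (fun k : ℕ => ‖zm k - 1‖ / ((k : ℝ) / Real.log k)) atTop (𝓝 1)) ∧
    Tendsto (fun k : ℕ => chromaticRadius (uniformThetaGraph 2 k) / ((k : ℝ) / Real.log k))
      atTop (𝓝 1) := by
  have hπ : |Real.pi| ≤ 4 := by rw [abs_of_pos Real.pi_pos]; exact Real.pi_le_four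
  obtain ⟨zp, εp, hp⟩ := exists_chromaticRoot_expansion hπ Complex.exp_pi_mul_I
  obtain ⟨zm, εm, hm⟩ := exists_chromaticRoot_expansion (a := -Real.pi) (by rwa [abs_neg])
    (by rw [Complex.ofReal_neg, neg_mul, Complex.exp_neg, Complex.exp_pi_mul_I]; norm_num)
  have hO {ε : ℕ → ℂ}
      (h : ∀ᶠ k : ℕ in atTop, ‖ε k‖ ≤ 69 * (Real.log (Real.log k) / Real.log k ^ 2)) :
      ε =O[atTop] (fun k : ℕ => Real.log (Real.log k) / Real.log k ^ 2) :=
    IsBigO.of_bound 69 (h.mono fun k hk => hk.trans (by gcongr; exact le_abs_self _))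
  have hpO := hO (hp.mono fun k h => h.2.2)
  have hmO := hO (hm.mono fun k h => h.2.2)
  have hpT := tendsto_norm_sub_one_div (hpO.trans_tendsto tendsto_log_log_natCast_div_sq)
    (hp.mono fun k h => h.2.1)
  have hmT := tendsto_norm_sub_one_div (hmO.trans_tendsto tendsto_log_log_natCast_div_sq)
    (hm.mono fun k h => h.2.1)
  refine ⟨fun k => ⟨uniformThetaGraphTwoIso k⟩, ⟨zp, zm, εp, εm, ?_, hpO, hmO, hpT, hmT⟩,
    tendsto_order.2 ⟨fun b hb => ?_, fun b hb => eventually_chromaticRadius_lt hb⟩⟩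
  -- If the two roots coincided, then `2π / L = ‖εm - εp‖ ≤ 138 log L / L^2` with `L = log k`; the
  -- threshold `1/69` would make `2π < 2`.
  · filter_upwards [hp, hm, eventually_log_natCast,
      tendsto_log_log_natCast_div.eventually_lt_const (by norm_num : (0 : ℝ) < 1 / 69)]
      with k ⟨h1, h2, h3⟩ ⟨h4, h5, h6⟩ ⟨hk0, hℓ, hL, _⟩ hsmall
    refine ⟨h1, h4, fun heq => ?_, h2, ?_⟩
    · have hL0 : 0 < Real.log k := by linarith
      have hkc : (k : ℂ) ≠ 0 := by exact_mod_cast hk0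
      have hMc : ((Real.log k - Real.log (Real.log k) : ℝ) : ℂ) ≠ 0 := by
        exact_mod_cast (by linarith : 0 < Real.log k - Real.log (Real.log k)).ne'
      rw [h2, h5] at heq
      have h7 := mul_left_cancel₀ (div_ne_zero hkc hMc) heq
      have h8 : (2 * Real.pi : ℂ) * Complex.I / (Real.log k : ℂ) = εm k - εp k := by
        rw [Complex.ofReal_neg] at h7
        linear_combination h7
      have h9 := congrArg norm h8
      rw [norm_div, norm_mul, norm_mul, Complex.norm_I, Complex.norm_real, Complex.norm_real,
        Real.norm_eq_abs, Real.norm_eq_abs, abs_of_pos hL0, abs_of_pos Real.pi_pos,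
        Complex.norm_two, mul_one] at h9
      have h10 := (h9.le.trans (norm_sub_le _ _)).trans (add_le_add h6 h3)
      rw [div_le_iff₀ hL0] at h10
      have h11 : Real.log (Real.log k) / Real.log k ^ 2 * Real.log k =
          Real.log (Real.log k) / Real.log k := by field_simp
      have := Real.pi_gt_three
      linarith
    · rw [h5, Complex.ofReal_neg]
      ring
  -- The root `zp k` alone bounds the radius from below.
  · filter_upwards [hp, hpT.eventually_const_lt hb] with k h1 h2
    refine h2.trans_le ?_
    have := (chromaticRadius_isGreatest (uniformThetaGraph 2 k)).2 ⟨zp k, h1.1, rfl⟩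
    gcongr
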